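/- **Setting.** Let $m\ge 2$, $\alpha\ge 0$, $L>0$, $\sigma>0$. The class $\mathcal H(\alpha,L)$ consists of all $f\colon[0,1]^m\to\mathbb R$ such that for every $x_0\in[0,1]^m$ there is a polynomial $P_{x_0}$ of degree at most $\lfloor\alpha\rfloor$ with $|f(x)-P_{x_0}(x-x_0)|\le L\|x-x_0\|_\infty^\alpha$ for all $x\in[0,1]^m$. Every such $f$ is bounded. Let $\mathcal P(\alpha,L)$ be the set of tensors $\Theta\in\mathbb R^{d\times\cdots\times d}$ (order $m$) with $\Theta(i_1,\dots,i_m)=f(i_1/d,\dots,i_m/d)$ for some $f\in\mathcal H(\alpha,L)$, and for $B\in\mathbb R$ let $\mathcal P_B(\alpha,L)$ be the set of those generated by some $f\in\mathcal H(\alpha,L)$ with $|f|\le B$. For a permutation $\pi$ of $[d]$ write $(\Theta\circ\pi)(i_1,\dots,i_m)=\Theta(\pi(i_1),\dots,\pi(i_m))$. We observe $\mathcal Y=\Theta\circ\pi+\mathcal E$, where the entries of $\mathcal E$ are independent, zero-mean and sub-Gaussian with variance proxy $\sigma^2$ (not necessarily identically distributed). For integers $k\ge1$, $\ell\ge0$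 let $z(i)=\lceil ki/d\rceil$, and let $\mathscr B(k,\ell)$ be the set of tensors which on every block $z^{-1}(j_1)\times\cdots\times z^{-1}(j_m)$ coincide with a polynomial of total degree at most $\ell$ in $(i_1,\dots,i_m)$. A least-squares estimator is any minimizer $(\hat\Theta,\hat\pi)$ of $\|\mathcal Y-\Theta'\circ\pi'\|_F$ over $\Theta'\in\mathscr B(k,\ell)$ and all permutations $\pi'$ of $[d]$. Put $\mathrm{MSE}=d^{-m}\|\hat\Theta\circ\hat\pi-\Theta\circ\pi\|_F^2$ and $$R_d(k,\ell)=\frac{L^2}{k^{2\min(\alpha,\ell+1)}}+\sigma^2\Big(\frac{k^m(\ell+m)^\ell}{d^m}+\frac{\log d}{d^{m-1}}\Big).$$ "With high probability" means with probability tending to $1$ as $d\to\infty$, uniformly over the signals in the class named, over $\pi$, over the noise distribution, over the choice of the minimizer and, in part 1, over $k$ and $\ell$. **Theorem (Least-squares estimation error).** 1. (a) There is a constant $C=C(m,\alpha)$ such that for all $L,\sigma>0$, over $\Theta\in\mathcal P(\alpha,L)$, all $1\le k\le d$ and all $\ell\ge\lfloor\alpha\rfloor$, $\mathrm{MSE}\le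 C\,R_d(k,\ell)$ with high probability. (b) For every $B$ there is a constant $C=C(m,\alpha,L,B)$ such that for all $\sigma>0$, over $\Theta\in\mathcal P_B(\alpha,L)$, all $1\le k\le d$ and all $\ell\ge0$, $\mathrm{MSE}\le C\,R_d(k,\ell)$ with high probability. 2. Let $\ell^*=\min(\lfloor\alpha\rfloor,(m-2)(m+1)/2)$ and $k^*=\big\lceil (d^mL^2/\sigma^2)^{1/(m+2\min(\alpha,\ell^*+1))}\big\rceil$. There is a constant $C=C(m,\alpha)$ such that, for all $L,\sigma>0$: (a) if $\alpha<m(m-1)/2$, then $R_d(k^*,\ell^*)\le C\,L^2(\sigma/L)^{4\alpha/(m+2\alpha)}\,d^{-2m\alpha/(m+2\alpha)}$ for all large $d$, and over $\Theta\in\mathcal P(\alpha,L)$ the least-squares estimator with $(k^*,\ell^*)$ has MSE at most the same right-hand side with high probability; (b) if $\alpha\ge m(m-1)/2$, then $R_d(k^*,\ell^*)\le C\,\sigma^2d^{-(m-1)}\log d$ for all large $d$, and for every $B$, over $\Theta\in\mathcal P_B(\alpha,L)$, the least-squares estimator with $(k^*,\ell^*)$ has MSE at most the same right-hand side with high probability.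 -/

import Mathlib

open MeasureTheory ProbabilityTheory Filter
open scoped NNReal ENNReal

universe u

noncomputable section

/-- Order-`m`, `d`-dimensional real tensors. The index `i : Fin d` stands for `i + 1 ∈ {1, …, d}`. -/
abbrev Tensor (m d : ℕ) : Type := (Fin m → Fin d) → ℝ

/-- The permuted tensor `(Θ ∘ π)(i₁, …, iₘ) = Θ(π(i₁), …, π(iₘ))`. -/
def Tensor.permute {m d : ℕ} (Θ : Tensor m d) (π : Equiv.Perm (Fin d)) : Tensor m d :=
  fun i => Θ (fun a => π (i a))

/-- The Frobenius norm. -/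
def frobNorm {m d : ℕ} (Θ : Tensor m d) : ℝ := Real.sqrt (∑ i, Θ i ^ 2)

/-- The mean squared error `d⁻ᵐ ‖Θ₁ - Θ₂‖_F²`. -/
def mse {m d : ℕ} (Θ₁ Θ₂ : Tensor m d) : ℝ := frobNorm (Θ₁ - Θ₂) ^ 2 / (d : ℝ) ^ m

/-- The unit cube `[0,1]ᵐ`. -/
def unitCube (m : ℕ) : Set (Fin m → ℝ) := Set.Icc 0 1

/-- The `α`-Hölder class `H(α, L)` on `[0,1]ᵐ`: around every `x₀` there is a polynomial in `x - x₀`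
of degree at most `⌊α⌋` approximating `f` up to `L ‖x - x₀‖_∞ ^ α`.
(The norm on `Fin m → ℝ` is the sup norm; values of `f` off the cube play no role.) -/
def holderClass (m : ℕ) (α L : ℝ) : Set ((Fin m → ℝ) → ℝ) :=
  {f | ∀ x₀ ∈ unitCube m, ∃ P : MvPolynomial (Fin m) ℝ, P.totalDegree ≤ ⌊α⌋₊ ∧
    ∀ x ∈ unitCube m, |f x - MvPolynomial.eval (x - x₀) P| ≤ L * ‖x - x₀‖ ^ α}

/-- The functions that are bounded by `B` in absolute value on the cube. -/
def boundedBy (m : ℕ) (B : ℝ) : Set ((Fin m → ℝ) → ℝ) :=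
  {f | ∀ x ∈ unitCube m, |f x| ≤ B}

/-- Every Hölder function is bounded, so `H(α, L)` is the union over `B` of
`H(α, L) ∩ boundedBy m B`. -/
theorem exists_boundedBy_of_mem_holderClass {m : ℕ} {α L : ℝ} (hα : 0 ≤ α) (hL : 0 ≤ L)
    {f : (Fin m → ℝ) → ℝ} (hf : f ∈ holderClass m α L) : ∃ B, f ∈ boundedBy m B := by
  obtain ⟨P, -, hP⟩ := hf 0 ⟨le_refl _, zero_le_one⟩
  have hc : IsCompact (unitCube m) := isCompact_Icc
  obtain ⟨K, hK⟩ := hc.exists_bound_of_continuousOn (MvPolynomial.continuous_eval P).continuousOn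
  refine ⟨L + K, fun x hx => ?_⟩
  have h1 := hP x hx
  have h2 := hK x hx
  rw [sub_zero] at h1
  have h3 : ‖x‖ ≤ 1 := by
    refine (pi_norm_le_iff_of_nonneg zero_le_one).2 fun a => ?_
    rw [Real.norm_eq_abs, abs_of_nonneg (hx.1 a)]
    exact hx.2 a
  have h4 : L * ‖x‖ ^ α ≤ L * 1 :=
    mul_le_mul_of_nonneg_left (Real.rpow_le_one (norm_nonneg x) h3 hα) hL
  rw [Real.norm_eq_abs] at h2
  have h5 := abs_add_le (f x - MvPolynomial.eval x P) (MvPolynomial.eval x P)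
  rw [sub_add_cancel] at h5
  linarith

/-- Discretization on the grid: `Θ(i₁, …, iₘ) = f(i₁/d, …, iₘ/d)`. -/
def gridTensor (m d : ℕ) (f : (Fin m → ℝ) → ℝ) : Tensor m d :=
  fun i => f (fun a => ((i a : ℕ) + 1 : ℝ) / d)

/-- The tensors generated by a class of functions; `smoothTensors d (holderClass m α L)` is the
smooth tensor class `P(α, L)`. -/
def smoothTensors {m : ℕ} (d : ℕ) (F : Set ((Fin m → ℝ) → ℝ)) : Set (Tensor m d) :=
  gridTensor m d '' F

/-- The canonical clustering function `z(i) = ⌈k i / d⌉`. -/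
def cluster (d k : ℕ) (i : Fin d) : ℕ := ⌈(k : ℝ) * ((i : ℕ) + 1) / d⌉₊

/-- The class `B(k, ℓ)` of block-`k`, degree-`ℓ` polynomial tensors: on each block
`z⁻¹(j₁) × ⋯ × z⁻¹(jₘ)` the entry at `(i₁, …, iₘ)` is a polynomial in `(i₁, …, iₘ)` of total
degree at most `ℓ`, which depends on the block. -/
def blockPoly (m d k ℓ : ℕ) : Set (Tensor m d) :=
  {T | ∃ P : (Fin m → ℕ) → MvPolynomial (Fin m) ℝ, (∀ j, (P j).totalDegree ≤ ℓ) ∧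
    ∀ i, T i = MvPolynomial.eval (fun a => ((i a : ℕ) + 1 : ℝ)) (P (fun a => cluster d k (i a)))}

/-- `(Θ', π')` minimizes `‖Y - Θ ∘ π‖_F` over `Θ ∈ B(k, ℓ)` and all permutations `π`. -/
def IsLSE {m d : ℕ} (k ℓ : ℕ) (Y Θ' : Tensor m d) (π' : Equiv.Perm (Fin d)) : Prop :=
  Θ' ∈ blockPoly m d k ℓ ∧
    ∀ Θ ∈ blockPoly m d k ℓ, ∀ π : Equiv.Perm (Fin d),
      frobNorm (Y - Θ'.permute π') ≤ frobNorm (Y - Θ.permute π)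

/-- The noise tensor: independent zero-mean entries, sub-Gaussian with variance proxy `σ²`, not
necessarily identically distributed. -/
structure IsNoise {m d : ℕ} {Ω : Type u} [MeasurableSpace Ω] (μ : Measure Ω) (σ : ℝ)
    (E : Ω → Tensor m d) : Prop where
  measurable : ∀ i, Measurable fun w => E w i
  indep : iIndepFun (fun i w => E w i) μ
  mean_zero : ∀ i, ∫ w, E w i ∂μ = 0
  subGaussian : ∀ i, HasSubgaussianMGF (fun w => E w i) (σ ^ 2).toNNReal μ

/-- For every signal `Θ ∈ 𝒯`, every permutation `π`, every noise `E` with variance proxy `σ²` and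
every least-squares estimator computed from `Y = Θ ∘ π + E` with block number `k` and degree `ℓ`,
the probability that the mean squared error of the estimator exceeds `R` is at most `ε`. -/
def LSEErrorBound {m d : ℕ} (𝒯 : Set (Tensor m d)) (σ : ℝ) (k ℓ : ℕ) (R : ℝ) (ε : ℝ≥0∞) : Prop :=
  ∀ Θ ∈ 𝒯, ∀ π : Equiv.Perm (Fin d),
  ∀ (Ω : Type u) [MeasurableSpace Ω] (μ : Measure Ω) [IsProbabilityMeasure μ]
    (E : Ω → Tensor m d), IsNoise μ σ E →
  ∀ (Θ' : Ω → Tensor m d) (π' : Ω → Equiv.Perm (Fin d)),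
    (∀ w, IsLSE k ℓ (Θ.permute π + E w) (Θ' w) (π' w)) →
    μ {w | R < mse ((Θ' w).permute (π' w)) (Θ.permute π)} ≤ ε

/-- The error bound
`L² / k^(2 min(α, ℓ+1)) + σ² (kᵐ (ℓ+m)^ℓ / dᵐ + log d / d^(m-1))`. -/
def lseRate (m : ℕ) (α L σ : ℝ) (d k ℓ : ℕ) : ℝ :=
  L ^ 2 / (k : ℝ) ^ (2 * min α (ℓ + 1)) +
    σ ^ 2 * ((k : ℝ) ^ m * ((ℓ : ℝ) + m) ^ ℓ / (d : ℝ) ^ m + Real.log d / (d : ℝ) ^ (m - 1))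

/-- The tuned degree `ℓ* = min(⌊α⌋, (m-2)(m+1)/2)`. -/
def degStar (m : ℕ) (α : ℝ) : ℕ := min ⌊α⌋₊ ((m - 2) * (m + 1) / 2)

/-- The tuned block number `k* = ⌈(dᵐ L² / σ²)^(1 / (m + 2 min(α, ℓ*+1)))⌉`. -/
def blockStar (m : ℕ) (α L σ : ℝ) (d : ℕ) : ℕ :=
  ⌈((d : ℝ) ^ m * L ^ 2 / σ ^ 2) ^ (1 / ((m : ℝ) + 2 * min α ((degStar m α : ℝ) + 1)))⌉₊

end

/-!
The theorem follows from a deterministic inequality, a concentration bound and an approximation bound.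

*Least squares.* Up to the permutation, the candidate tensors form linear spaces: `blockSpan` contains
all `A ∘ π` with `A` block polynomial and `π` fixed, and it has dimension at most `kᵐ (ℓ + m) ^ ℓ`,
since a monomial of degree at most `ℓ` is a product of `ℓ` factors taken from `1, x₁, …, xₘ`. If `A` is a
block polynomial tensor with `|Θ - A| ≤ δ` entrywise, the estimator `H = Θ̂ ∘ π̂` and `A ∘ π` both lie in
the space `W` spanned by the copies for `π̂` and `π`, and comparing residuals gives
`‖H - Θ ∘ π‖ ≤ 3 ‖Θ ∘ π - A ∘ π‖ + 2 ‖P_W E‖` (`norm_sub_le_of_norm_add_sub_le`).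

*Noise.* For a fixed `W`, writing the exponential of a square as a Gaussian average of exponentials of
linear forms gives `𝔼 exp (‖P_W E‖² / (4σ²)) ≤ √2 ^ dim W`, hence the tail bound
`measure_norm_sq_starProjection_gt_le`. A union bound over the `d!` values of `π̂` costs `log d! ≤ d log d`,
which is the term `log d / d ^ (m - 1)` of the rate. The result is `LSEErrorBound.of_approx`: the mean
squared error is at most `18 δ²` plus `64` times the stochastic term, except with probability `1 / d`.

*Approximation.* The local polynomials of a Hölder function at the points `z / k` give `δ = L k ^ (-α)` when
`⌊α⌋ ≤ ℓ`. When `ℓ < ⌊α⌋` they are truncated at degree `ℓ`. Evaluation on a finite grid is injective on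
polynomials of bounded degree, so a bound on the function bounds all their coefficients, uniformly in the
base point (`exists_sum_abs_coeff_le`), and `δ` is of order `k ^ (-(ℓ + 1))`.

*Tuning.* With approximation exponent `p`, the number of blocks `k*` gives the bias and the variance the
same order, `balancedRate`. It dominates `log d / d ^ (m - 1)` when `p < m (m - 1) / 2`. When
`m (m - 1) / 2 ≤ α`, the degree `ℓ*` makes `p = m (m - 1) / 2`, so that `balancedRate` is of order
`d ^ (-(m - 1))`, and the extra factor `log d` absorbs every constant that depends on the signal class.
None of this needs `k ≤ d`, which matters because `k*` may exceed `d` when `α = 0`.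
-/

/-! ### Concentration of projections of sub-Gaussian vectors -/

theorem integral_exp_sq_div_four_gaussian :
    Integrable (fun x : ℝ => Real.exp (x ^ 2 / 4)) (gaussianReal 0 1) ∧
      ∫ x, Real.exp (x ^ 2 / 4) ∂(gaussianReal 0 1) = √2 := by
  have key : ∀ x : ℝ, gaussianPDFReal 0 1 x * Real.exp (x ^ 2 / 4) =
      (√(2 * Real.pi))⁻¹ * Real.exp (-(1 / 4) * x ^ 2) := by
    intro x
    simp only [gaussianPDFReal, NNReal.coe_one, mul_one, sub_zero, mul_assoc, ← Real.exp_add]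
    congr 2
    ring
  constructor
  · rw [gaussianReal_of_var_ne_zero 0 one_ne_zero,
      integrable_withDensity_iff_integrable_smul' (measurable_gaussianPDF 0 1)
        (ae_of_all _ fun x => by simp [gaussianPDF])]
    simp only [toReal_gaussianPDF, smul_eq_mul, key]
    exact (integrable_exp_neg_mul_sq (by norm_num)).const_mul _
  · rw [integral_gaussianReal_eq_integral_smul one_ne_zero]
    simp only [smul_eq_mul, key]
    rw [integral_const_mul, integral_gaussian, ← Real.sqrt_inv, ← Real.sqrt_mul (by positivity)]
    congr 1
    field_simp
    norm_num

theorem lintegral_pi_ofReal_prod {κ : Type*} [Fintype κ] {ν : Measure ℝ} [IsProbabilityMeasure ν]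
    (f : κ → ℝ → ℝ) (hf : ∀ j, Integrable (f j) ν) (h0 : ∀ j x, 0 ≤ f j x) :
    ∫⁻ g, ENNReal.ofReal (∏ j, f j (g j)) ∂(Measure.pi fun _ : κ => ν) =
      ENNReal.ofReal (∏ j, ∫ x, f j x ∂ν) := by
  rw [← integral_fintype_prod_eq_prod (μ := fun _ => ν), ofReal_integral_eq_lintegral_ofReal
    (Integrable.fintype_prod (μ := fun _ => ν) hf)]
  exact ae_of_all _ fun g => Finset.prod_nonneg fun j _ => h0 j _

/-- The Laplace transform bound for a linear form in independent sub-Gaussian variables. -/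
theorem lintegral_exp_linear_le {Ω ι : Type*} [MeasurableSpace Ω] {μ : Measure Ω}
    [IsProbabilityMeasure μ] [Fintype ι] {X : ι → Ω → ℝ} {c : ℝ≥0} (hi : iIndepFun X μ)
    (hX : ∀ i, HasSubgaussianMGF (X i) c μ) (u : ι → ℝ) :
    ∫⁻ w, ENNReal.ofReal (Real.exp (∑ i, u i * X i w)) ∂μ ≤
      ENNReal.ofReal (Real.exp (c * (∑ i, u i ^ 2) / 2)) := by
  have h := HasSubgaussianMGF.sum_of_iIndepFun (s := Finset.univ)
    (hi.comp (fun i x => u i * x) fun i => measurable_const_mul _)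
    fun i _ => (hX i).const_mul (u i)
  have h1 := h.integrable_exp_mul 1
  have h2 := h.mgf_le 1
  simp only [mgf, one_mul, Function.comp_apply] at h1 h2
  rw [← ofReal_integral_eq_lintegral_ofReal h1 (ae_of_all _ fun _ => (Real.exp_pos _).le)]
  refine ENNReal.ofReal_le_ofReal (h2.trans_eq ?_)
  congr 1
  rw [one_pow, mul_one, NNReal.coe_sum, Finset.mul_sum]
  refine congrArg (· / 2) (Finset.sum_congr rfl fun i _ => ?_)
  exact mul_comm (u i ^ 2) (c : ℝ)

/-- Gaussian decoupling: the coordinates of a sub-Gaussian vector along an orthonormal family need not be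
independent, but the exponential moment of the sum of their squares is bounded as if they were standard
Gaussian. -/
theorem lintegral_exp_sum_sq_le {Ω ι κ : Type*} [MeasurableSpace Ω] {μ : Measure Ω}
    [IsProbabilityMeasure μ] [Fintype ι] [Fintype κ] {X : ι → Ω → ℝ} {c : ℝ≥0} (hc : 0 < c)
    (hm : ∀ i, Measurable (X i)) (hi : iIndepFun X μ) (hX : ∀ i, HasSubgaussianMGF (X i) c μ)
    (v : κ → EuclideanSpace ℝ ι) (hv : Orthonormal ℝ v) :
    ∫⁻ w, ENNReal.ofReal (Real.exp ((∑ j, (∑ i, v j i * X i w) ^ 2) / (4 * c))) ∂μ ≤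
      ENNReal.ofReal (√2 ^ Fintype.card κ) := by
  set γ : Measure (κ → ℝ) := Measure.pi fun _ => gaussianReal 0 1
  have hc' : (0 : ℝ) < c := hc
  set s : ℝ := (√(2 * c))⁻¹
  have hs : s ^ 2 = (2 * c : ℝ)⁻¹ := by
    rw [inv_pow, Real.sq_sqrt (by positivity)]
  have hexp : ∀ a : ℝ, Integrable (fun x => Real.exp (a * x)) (gaussianReal 0 1) := fun a =>
    integrable_exp_mul_gaussianReal a
  have hmgf : ∀ a : ℝ, ∫ x, Real.exp (a * x) ∂(gaussianReal 0 1) = Real.exp (a ^ 2 / 2) := by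
    intro a
    have := congrFun (mgf_fun_id_gaussianReal (μ := 0) (v := 1)) a
    simpa [mgf] using this
  -- Each exponential of squares is a Gaussian average of exponentials of linear forms.
  have h1 : ∀ w, ENNReal.ofReal (Real.exp ((∑ j, (∑ i, v j i * X i w) ^ 2) / (4 * c))) =
      ∫⁻ g, ENNReal.ofReal (Real.exp (∑ i, (∑ j, s * g j * v j i) * X i w)) ∂γ := by
    intro w
    have := lintegral_pi_ofReal_prod (ν := gaussianReal 0 1)
      (fun j x => Real.exp (s * (∑ i, v j i * X i w) * x)) (fun j => hexp _)
      (fun j x => (Real.exp_pos _).le)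
    simp only [hmgf, ← Real.exp_sum] at this
    convert this.symm using 3
    · rw [Finset.sum_div]
      refine Finset.sum_congr rfl fun j _ => ?_
      rw [mul_pow, hs]
      field_simp
      norm_num
    · congr 2
      simp only [Finset.sum_mul, Finset.mul_sum]
      rw [Finset.sum_comm]
      exact Finset.sum_congr rfl fun j _ => Finset.sum_congr rfl fun i _ => by ring
  have hn : ∀ g : κ → ℝ, ∑ i, (∑ j, s * g j * v j i) ^ 2 = s ^ 2 * ∑ j, g j ^ 2 := by
    intro g
    have e : ‖∑ j, (s * g j) • v j‖ ^ 2 = ∑ j, (s * g j) ^ 2 := by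
      rw [← real_inner_self_eq_norm_sq, hv.inner_sum]
      simp [sq]
    rw [EuclideanSpace.norm_sq_eq] at e
    simp only [mul_pow, ← Finset.mul_sum] at e
    rw [← e]
    refine Finset.sum_congr rfl fun i _ => ?_
    simp [WithLp.ofLp_sum, Finset.sum_apply]
  simp only [h1]
  rw [lintegral_lintegral_swap]
  · calc ∫⁻ g, ∫⁻ w, ENNReal.ofReal (Real.exp (∑ i, (∑ j, s * g j * v j i) * X i w)) ∂μ ∂γ
        ≤ ∫⁻ g, ENNReal.ofReal (∏ j, Real.exp (g j ^ 2 / 4)) ∂γ := by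
          refine lintegral_mono fun g => (lintegral_exp_linear_le hi hX _).trans_eq ?_
          rw [hn, hs, ← Real.exp_sum, ← Finset.sum_div]
          congr 2
          field_simp
          ring
      _ = ENNReal.ofReal (√2 ^ Fintype.card κ) := by
          rw [lintegral_pi_ofReal_prod (fun _ x => Real.exp (x ^ 2 / 4))
            (fun _ => integral_exp_sq_div_four_gaussian.1) (fun _ _ => (Real.exp_pos _).le)]
          simp [integral_exp_sq_div_four_gaussian.2]
  · have : Measurable fun p : Ω × (κ → ℝ) =>
        ENNReal.ofReal (Real.exp (∑ i, (∑ j, s * p.2 j * v j i) * X i p.1)) := by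
      have hm' : ∀ i, Measurable fun p : Ω × (κ → ℝ) => X i p.1 := fun i =>
        (hm i).comp measurable_fst
      fun_prop
    exact this.aemeasurable

/-- The squared norm of the projection of a sub-Gaussian vector onto a subspace of dimension at most `r`
exceeds `4 c (r + t)` with probability at most `exp (-t)`. -/
theorem measure_norm_sq_starProjection_gt_le {Ω ι : Type*} [MeasurableSpace Ω] {μ : Measure Ω}
    [IsProbabilityMeasure μ] [Fintype ι] {X : ι → Ω → ℝ} {c : ℝ≥0} (hc : 0 < c)
    (hm : ∀ i, Measurable (X i)) (hi : iIndepFun X μ) (hX : ∀ i, HasSubgaussianMGF (X i) c μ)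
    (W : Submodule ℝ (EuclideanSpace ℝ ι)) {r : ℝ} (hr : (Module.finrank ℝ W : ℝ) ≤ r) (t : ℝ) :
    μ {w | 4 * c * (r + t) < ‖W.starProjection (WithLp.toLp 2 fun i => X i w)‖ ^ 2} ≤
      ENNReal.ofReal (Real.exp (-t)) := by
  have hc' : (0 : ℝ) < c := hc
  let b := stdOrthonormalBasis ℝ W
  have hv : Orthonormal ℝ fun j => (b j : EuclideanSpace ℝ ι) :=
    b.orthonormal.comp_linearIsometry W.subtypeₗᵢ
  have hnorm : ∀ w, ‖W.starProjection (WithLp.toLp 2 fun i => X i w)‖ ^ 2 =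
      ∑ j, (∑ i, (b j : EuclideanSpace ℝ ι) i * X i w) ^ 2 := by
    intro w
    rw [Submodule.starProjection_apply, ← Submodule.coe_norm, ← b.sum_sq_norm_inner_right]
    refine Finset.sum_congr rfl fun j _ => ?_
    rw [Submodule.inner_orthogonalProjectionOnto_eq_of_mem_left, PiLp.inner_apply,
      Real.norm_eq_abs, sq_abs]
    congr 1
    exact Finset.sum_congr rfl fun i _ => by simp [mul_comm]
  have hE := lintegral_exp_sum_sq_le hc hm hi hX _ hv
  set F : Ω → ℝ := fun w => ∑ j, (∑ i, (b j : EuclideanSpace ℝ ι) i * X i w) ^ 2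
  have hmk := mul_meas_ge_le_lintegral (μ := μ)
    (f := fun w => ENNReal.ofReal (Real.exp (F w / (4 * c)))) (by fun_prop)
    (ENNReal.ofReal (Real.exp (r + t)))
  have hsub : {w | 4 * c * (r + t) < ‖W.starProjection (WithLp.toLp 2 fun i => X i w)‖ ^ 2} ⊆
      {w | ENNReal.ofReal (Real.exp (r + t)) ≤ ENNReal.ofReal (Real.exp (F w / (4 * c)))} := by
    intro w hw
    rw [Set.mem_ofPred_eq, hnorm] at hw
    refine ENNReal.ofReal_le_ofReal (Real.exp_le_exp.2 ?_)
    rw [le_div_iff₀ (by positivity), mul_comm]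
    exact hw.le
  -- `√2 < e`, so the dimension factor `√2 ^ r` is paid for by the shift `r` of the threshold.
  have hsq : √2 ^ Module.finrank ℝ W ≤ Real.exp r := by
    have h2 : √2 ≤ Real.exp 1 := by
      have h3 : √2 ≤ 2 := by
        rw [Real.sqrt_le_left (by norm_num)]; norm_num
      linarith [Real.add_one_le_exp (1 : ℝ)]
    calc √2 ^ Module.finrank ℝ W ≤ Real.exp 1 ^ Module.finrank ℝ W := by gcongr
      _ = Real.exp (Module.finrank ℝ W) := by rw [← Real.exp_nat_mul, mul_one]
      _ ≤ Real.exp r := Real.exp_le_exp.2 hr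
  rw [Fintype.card_fin] at hE
  have hfin : ENNReal.ofReal (Real.exp (r + t)) * μ {w | ENNReal.ofReal (Real.exp (r + t)) ≤
      ENNReal.ofReal (Real.exp (F w / (4 * c)))} ≤
      ENNReal.ofReal (Real.exp (r + t)) * ENNReal.ofReal (Real.exp (-t)) := by
    refine (hmk.trans hE).trans ?_
    rw [← ENNReal.ofReal_mul (Real.exp_pos _).le, ← Real.exp_add]
    exact ENNReal.ofReal_le_ofReal (by simpa using hsq)
  refine (measure_mono hsub).trans ?_
  exact (ENNReal.mul_le_mul_iff_right (by simp [Real.exp_pos]) ENNReal.ofReal_ne_top).1 hfin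

/-! ### Linear spaces of block polynomial tensors -/

/-- A monomial of degree at most `ℓ` is a product of `ℓ` factors, each `1` or a variable. -/
theorem exists_prod_elim_eq_monomial {m : ℕ} (ℓ : ℕ) (s : Fin m →₀ ℕ) (hs : s.degree ≤ ℓ) :
    ∃ g : Fin ℓ → Option (Fin m), ∀ x : Fin m → ℝ,
      ∏ q, (g q).elim 1 x = s.prod fun a e => x a ^ e := by
  induction ℓ generalizing s with
  | zero =>
    obtain rfl : s = 0 := (Finsupp.degree_eq_zero_iff s).1 (Nat.le_zero.1 hs)
    exact ⟨Fin.elim0, by simp⟩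
  | succ ℓ ih =>
    rcases eq_or_ne s 0 with rfl | h0
    · exact ⟨fun _ => none, by simp⟩
    obtain ⟨a, ha⟩ := Finsupp.ne_iff.1 h0
    obtain ⟨s', rfl⟩ : ∃ s', s = s' + Finsupp.single a 1 :=
      ⟨s - Finsupp.single a 1, (tsub_add_cancel_of_le
        (Finsupp.single_le_iff.2 (Nat.one_le_iff_ne_zero.2 ha))).symm⟩
    rw [map_add, Finsupp.degree_single] at hs
    obtain ⟨g, hg⟩ := ih s' (by omega)
    refine ⟨Fin.cons (some a) g, fun x => ?_⟩
    rw [Fin.prod_univ_succ, Finsupp.prod_add_index' (by simp) (by simp [pow_add])]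
    simp [hg, mul_comm]

theorem one_le_cluster {d k : ℕ} (hk : 1 ≤ k) (i : Fin d) : 1 ≤ cluster d k i := by
  have : 0 < d := i.pos
  exact Nat.ceil_pos.2 (by positivity)

theorem cluster_le {d k : ℕ} (i : Fin d) : cluster d k i ≤ k := by
  have h0 : (0 : ℝ) < d := by exact_mod_cast i.pos
  have h1 : ((i : ℕ) + 1 : ℝ) ≤ d := by exact_mod_cast i.isLt
  refine Nat.ceil_le.2 ((div_le_iff₀ h0).2 ?_)
  gcongr

/-- The products of at most `ℓ` coordinates (a factor `none` contributes `1`) on a single block, and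
zero off that block. -/
noncomputable def blockMonomial (m d k ℓ : ℕ) (p : (Fin m → Fin k) × (Fin ℓ → Option (Fin m))) :
    Tensor m d :=
  fun i => if (fun a => cluster d k (i a)) = (fun a => (p.1 a : ℕ) + 1) then
    ∏ q, (p.2 q).elim 1 (fun a => ((i a : ℕ) + 1 : ℝ)) else 0

theorem mem_span_blockMonomial {m d k ℓ : ℕ} (hk : 1 ≤ k) {T : Tensor m d}
    (hT : T ∈ blockPoly m d k ℓ) : T ∈ Submodule.span ℝ (Set.range (blockMonomial m d k ℓ)) := by
  obtain ⟨P, hP, hT⟩ := hT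
  have hg : ∀ s : Fin m →₀ ℕ, ∃ g : Fin ℓ → Option (Fin m), s.degree ≤ ℓ → ∀ x : Fin m → ℝ,
      ∏ q, (g q).elim 1 x = s.prod fun a e => x a ^ e := by
    intro s
    by_cases h : s.degree ≤ ℓ
    · obtain ⟨g, hg⟩ := exists_prod_elim_eq_monomial ℓ s h
      exact ⟨g, fun _ => hg⟩
    · exact ⟨fun _ => none, fun h' => absurd h' h⟩
  choose g hg using hg
  have hsum : T = ∑ j : Fin m → Fin k, ∑ s ∈ (P fun a => (j a : ℕ) + 1).support,
      (P fun a => (j a : ℕ) + 1).coeff s • blockMonomial m d k ℓ (j, g s) := by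
    funext i
    let j₀ : Fin m → Fin k := fun a => ⟨cluster d k (i a) - 1, by
      have := one_le_cluster hk (i a); have := cluster_le (k := k) (i a); omega⟩
    have hj₀ : (fun a => cluster d k (i a)) = fun a => (j₀ a : ℕ) + 1 := by
      funext a
      have := one_le_cluster hk (i a)
      simp only [j₀]; omega
    rw [hT i, hj₀, MvPolynomial.eval_eq, Finset.sum_apply, Finset.sum_eq_single j₀]
    · rw [Finset.sum_apply]
      refine Finset.sum_congr rfl fun s hs => ?_
      have hdeg : s.degree ≤ ℓ := by
        rw [Finsupp.degree_eq_sum]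
        have := MvPolynomial.le_totalDegree hs
        rw [Finsupp.sum_fintype _ _ (by simp)] at this
        exact this.trans (hP _)
      rw [Pi.smul_apply, blockMonomial, if_pos hj₀, hg s hdeg, smul_eq_mul]
      rfl
    · intro j _ hj
      rw [Finset.sum_apply]
      refine Finset.sum_eq_zero fun s _ => ?_
      rw [Pi.smul_apply, blockMonomial, if_neg, smul_zero]
      rw [hj₀]
      intro h
      exact hj (funext fun a => Fin.ext (by simpa using (congrFun h a).symm))
    · simp
  rw [hsum]
  exact Submodule.sum_mem _ fun j _ => Submodule.sum_mem _ fun s _ =>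
    Submodule.smul_mem _ _ (Submodule.subset_span ⟨_, rfl⟩)

/-- A subspace, in the Euclidean structure on tensors, that contains every permuted tensor `T ∘ π`
with `T` block polynomial. -/
noncomputable def blockSpan (m d k ℓ : ℕ) (π : Equiv.Perm (Fin d)) :
    Submodule ℝ (EuclideanSpace ℝ (Fin m → Fin d)) :=
  Submodule.span ℝ (Set.range fun p => WithLp.toLp 2 ((blockMonomial m d k ℓ p).permute π))

theorem toLp_permute_mem_blockSpan {m d k ℓ : ℕ} (hk : 1 ≤ k) {T : Tensor m d}
    (hT : T ∈ blockPoly m d k ℓ) (π : Equiv.Perm (Fin d)) :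
    WithLp.toLp 2 (T.permute π) ∈ blockSpan m d k ℓ π := by
  let φ : Tensor m d →ₗ[ℝ] EuclideanSpace ℝ (Fin m → Fin d) :=
    (WithLp.linearEquiv 2 ℝ (Tensor m d)).symm.toLinearMap ∘ₗ
      LinearMap.funLeft ℝ ℝ fun i a => π (i a)
  have h := Submodule.mem_map_of_mem (f := φ) (mem_span_blockMonomial hk hT)
  rw [Submodule.map_span, ← Set.range_comp] at h
  exact h

theorem finrank_blockSpan_le (m d k ℓ : ℕ) (π : Equiv.Perm (Fin d)) :
    Module.finrank ℝ (blockSpan m d k ℓ π) ≤ k ^ m * (ℓ + m) ^ ℓ := by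
  refine (finrank_range_le_card _).trans ?_
  simp only [Fintype.card_prod, Fintype.card_fun, Fintype.card_fin, Fintype.card_option]
  rcases ℓ.eq_zero_or_pos with rfl | hℓ
  · simp
  · exact Nat.mul_le_mul_left _ (Nat.pow_le_pow_left (by omega) _)

/-! ### The error of least squares for a given approximation error -/

/-- The basic inequality of least squares: only the projection of the noise `E` onto a subspace that
contains both the estimator `H` and the competitor `A` matters. -/
theorem norm_sub_le_of_norm_add_sub_le {V : Type*} [NormedAddCommGroup V] [InnerProductSpace ℝ V]
    (W : Submodule ℝ V) [W.HasOrthogonalProjection] {T E A H : V} (hA : A ∈ W) (hH : H ∈ W)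
    (h : ‖T + E - H‖ ≤ ‖T + E - A‖) : ‖H - T‖ ≤ 3 * ‖T - A‖ + 2 * ‖W.starProjection E‖ := by
  have hsq : ‖T + E - H‖ ^ 2 ≤ ‖T + E - A‖ ^ 2 := by gcongr
  have e1 : T + E - H = (T + E - A) - (H - A) := by abel
  have e2 : T + E - A = (T - A) + E := by abel
  have e3 : inner ℝ E (H - A) = inner ℝ (W.starProjection E) (H - A) := by
    rw [Submodule.inner_starProjection_left_eq_right,
      Submodule.starProjection_eq_self_iff.2 (W.sub_mem hH hA)]
  rw [e1, norm_sub_sq_real, e2, inner_add_left, e3] at hsq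
  have h1 := real_inner_le_norm (T - A) (H - A)
  have h2 := real_inner_le_norm (W.starProjection E) (H - A)
  have h3 : ‖H - A‖ ≤ 2 * ‖T - A‖ + 2 * ‖W.starProjection E‖ := by
    rcases (norm_nonneg (H - A)).eq_or_lt with h0 | h0
    · rw [← h0]; positivity
    · refine le_of_mul_le_mul_right ?_ h0
      nlinarith
  have h4 : ‖H - T‖ ≤ ‖H - A‖ + ‖T - A‖ := by
    rw [norm_sub_rev T A]
    simpa using norm_add_le (H - A) (A - T)
  linarith

theorem frobNorm_eq_norm_toLp {m d : ℕ} (Θ : Tensor m d) :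
    frobNorm Θ = ‖(WithLp.toLp 2 Θ : EuclideanSpace ℝ (Fin m → Fin d))‖ := by
  simp [frobNorm, EuclideanSpace.norm_eq]

theorem norm_sq_toLp_permute_sub_le {m d : ℕ} (Θ A : Tensor m d) {δ : ℝ}
    (h : ∀ i, |Θ i - A i| ≤ δ) (π : Equiv.Perm (Fin d)) :
    ‖(WithLp.toLp 2 (Θ.permute π) - WithLp.toLp 2 (A.permute π) :
      EuclideanSpace ℝ (Fin m → Fin d))‖ ^ 2 ≤ (d : ℝ) ^ m * δ ^ 2 := by
  rw [EuclideanSpace.norm_sq_eq]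
  refine (Finset.sum_le_card_nsmul _ _ (δ ^ 2) fun i _ => ?_).trans_eq (by simp)
  exact pow_le_pow_left₀ (norm_nonneg _) (h _) 2

/-- The union bound over all permutations, at deviation level `2 d log d`. -/
theorem card_perm_mul_exp_le {d : ℕ} (hd : 1 ≤ d) :
    (Fintype.card (Equiv.Perm (Fin d)) : ℝ) * Real.exp (-(2 * d * Real.log d)) ≤ (d : ℝ)⁻¹ := by
  have h0 : (0 : ℝ) < d := by exact_mod_cast hd
  have h1 : Real.exp (-(2 * d * Real.log d)) = (((d : ℝ) ^ d)⁻¹) ^ 2 := by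
    rw [← Real.exp_log (pow_pos h0 d), Real.log_pow, ← Real.exp_neg, ← Real.exp_nat_mul]
    congr 1
    push_cast
    ring
  rw [h1, Fintype.card_perm, Fintype.card_fin]
  have h2 : ((d.factorial : ℕ) : ℝ) ≤ (d : ℝ) ^ d := by exact_mod_cast Nat.factorial_le_pow d
  have h3 : (d : ℝ) ≤ (d : ℝ) ^ d := le_self_pow₀ (by exact_mod_cast hd) (by omega)
  calc ((d.factorial : ℕ) : ℝ) * (((d : ℝ) ^ d)⁻¹) ^ 2
      ≤ (d : ℝ) ^ d * (((d : ℝ) ^ d)⁻¹) ^ 2 := by gcongr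
    _ = ((d : ℝ) ^ d)⁻¹ := by field_simp
    _ ≤ (d : ℝ)⁻¹ := by gcongr

/-- The oracle inequality: approximability of all signals up to `δ` in every entry bounds the mean squared
error of least squares by `18 δ²` plus `64` times the stochastic term of the rate, except with
probability `1 / d`. -/
theorem LSEErrorBound.of_approx {m d : ℕ} (hm : 1 ≤ m) (hd : 1 ≤ d) {𝒯 : Set (Tensor m d)}
    {σ δ : ℝ} (hσ : 0 < σ) {k ℓ : ℕ} (hk : 1 ≤ k)
    (h : ∀ Θ ∈ 𝒯, ∃ A ∈ blockPoly m d k ℓ, ∀ i, |Θ i - A i| ≤ δ) :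
    LSEErrorBound.{u} 𝒯 σ k ℓ (18 * δ ^ 2 + 64 * (σ ^ 2 * ((k : ℝ) ^ m * ((ℓ : ℝ) + m) ^ ℓ /
      (d : ℝ) ^ m + Real.log d / (d : ℝ) ^ (m - 1)))) (ENNReal.ofReal (d : ℝ)⁻¹) := by
  intro Θ hΘ π Ω _ μ _ E hE Θ' π' hLSE
  obtain ⟨A, hA, hAδ⟩ := h Θ hΘ
  have h0 : (0 : ℝ) < d := by exact_mod_cast hd
  have hc : 0 < (σ ^ 2).toNNReal := by simpa using pow_pos hσ 2
  have hcσ : (((σ ^ 2).toNNReal : ℝ≥0) : ℝ) = σ ^ 2 := Real.coe_toNNReal _ (sq_nonneg σ)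
  set N : ℝ := (k : ℝ) ^ m * ((ℓ : ℝ) + m) ^ ℓ
  let W : Equiv.Perm (Fin d) → Submodule ℝ (EuclideanSpace ℝ (Fin m → Fin d)) := fun ρ =>
    blockSpan m d k ℓ ρ ⊔ blockSpan m d k ℓ π
  have hW : ∀ ρ, (Module.finrank ℝ (W ρ) : ℝ) ≤ 2 * N := by
    intro ρ
    have h1 : Module.finrank ℝ (W ρ) ≤ 2 * (k ^ m * (ℓ + m) ^ ℓ) :=
      (Submodule.finrank_add_le_finrank_add_finrank _ _).trans (by
        have := finrank_blockSpan_le m d k ℓ ρ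
        have := finrank_blockSpan_le m d k ℓ π
        omega)
    calc (Module.finrank ℝ (W ρ) : ℝ) ≤ ((2 * (k ^ m * (ℓ + m) ^ ℓ) : ℕ) : ℝ) := by exact_mod_cast h1
      _ = 2 * N := by push_cast; rfl
  let bad : Equiv.Perm (Fin d) → Set Ω := fun ρ =>
    {w | 4 * ((σ ^ 2).toNNReal : ℝ) * (2 * N + 2 * d * Real.log d) <
      ‖(W ρ).starProjection (WithLp.toLp 2 fun i => E w i)‖ ^ 2}
  have hbad : ∀ ρ, μ (bad ρ) ≤ ENNReal.ofReal (Real.exp (-(2 * d * Real.log d))) := fun ρ =>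
    measure_norm_sq_starProjection_gt_le hc hE.measurable hE.indep hE.subGaussian (W ρ) (hW ρ) _
  have hsub : {w | 18 * δ ^ 2 + 64 * (σ ^ 2 * (N / (d : ℝ) ^ m + Real.log d / (d : ℝ) ^ (m - 1))) <
      mse ((Θ' w).permute (π' w)) (Θ.permute π)} ⊆ ⋃ ρ, bad ρ := by
    intro w hw
    rw [Set.mem_ofPred_eq] at hw
    refine Set.mem_iUnion.2 ⟨π' w, ?_⟩
    by_contra hnot
    rw [Set.mem_ofPred_eq, not_lt, hcσ] at hnot
    obtain ⟨hmem, hmin⟩ := hLSE w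
    have hle := hmin A hA π
    simp only [frobNorm_eq_norm_toLp, WithLp.toLp_sub, WithLp.toLp_add] at hle
    have hmain := norm_sub_le_of_norm_add_sub_le (W (π' w))
      (Submodule.mem_sup_right (toLp_permute_mem_blockSpan hk hA π))
      (Submodule.mem_sup_left (toLp_permute_mem_blockSpan hk hmem (π' w))) hle
    have happ := norm_sq_toLp_permute_sub_le Θ A hAδ π
    set a := ‖(WithLp.toLp 2 (Θ.permute π) - WithLp.toLp 2 (A.permute π) :
      EuclideanSpace ℝ (Fin m → Fin d))‖
    set p := ‖(W (π' w)).starProjection (WithLp.toLp 2 (E w))‖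
    have hp : p ^ 2 ≤ 4 * σ ^ 2 * (2 * N + 2 * d * Real.log d) := hnot
    have hsq := pow_le_pow_left₀ (norm_nonneg _) hmain 2
    have hpow : (d : ℝ) ^ m = d * (d : ℝ) ^ (m - 1) := by
      rw [← pow_succ', Nat.sub_add_cancel hm]
    refine hw.not_ge ?_
    rw [mse, frobNorm_eq_norm_toLp, WithLp.toLp_sub, div_le_iff₀ (by positivity)]
    calc _ ≤ (3 * a + 2 * p) ^ 2 := hsq
      _ ≤ 18 * a ^ 2 + 8 * p ^ 2 := by nlinarith [sq_nonneg (3 * a - 2 * p)]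
      _ ≤ 18 * ((d : ℝ) ^ m * δ ^ 2) + 8 * (4 * σ ^ 2 * (2 * N + 2 * d * Real.log d)) := by gcongr
      _ = _ := by
        rw [hpow]
        field_simp
        ring
  calc μ _ ≤ μ (⋃ ρ, bad ρ) := measure_mono hsub
    _ ≤ ∑ ρ, μ (bad ρ) := measure_iUnion_fintype_le _ _
    _ ≤ ∑ _ρ : Equiv.Perm (Fin d), ENNReal.ofReal (Real.exp (-(2 * d * Real.log d))) :=
        Finset.sum_le_sum fun ρ _ => hbad ρ
    _ = ENNReal.ofReal ((Fintype.card (Equiv.Perm (Fin d)) : ℝ) *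
          Real.exp (-(2 * d * Real.log d))) := by
        rw [Finset.sum_const, Finset.card_univ, nsmul_eq_mul,
          ENNReal.ofReal_mul (Nat.cast_nonneg _), ENNReal.ofReal_natCast]
    _ ≤ _ := ENNReal.ofReal_le_ofReal (card_perm_mul_exp_le hd)

/-! ### Approximation of Hölder functions by block polynomials -/

theorem totalDegree_bind₁_le {τ κ : Type*} (q : τ → MvPolynomial κ ℝ)
    (hq : ∀ a, (q a).totalDegree ≤ 1) (P : MvPolynomial τ ℝ) :
    (MvPolynomial.bind₁ q P).totalDegree ≤ P.totalDegree := by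
  rw [MvPolynomial.bind₁, MvPolynomial.aeval_def, MvPolynomial.eval₂_eq]
  refine MvPolynomial.totalDegree_finsetSum_le fun s hs => ?_
  refine (MvPolynomial.totalDegree_mul _ _).trans ?_
  rw [MvPolynomial.algebraMap_eq, MvPolynomial.totalDegree_C, zero_add]
  refine (MvPolynomial.totalDegree_finsetProd _ _).trans
    (le_trans (Finset.sum_le_sum fun a _ => ?_) (MvPolynomial.le_totalDegree hs))
  exact (MvPolynomial.totalDegree_pow _ _).trans (by nlinarith [hq a])

theorem grid_mem_Icc {d : ℕ} (i : Fin d) : ((i : ℕ) + 1 : ℝ) / d ∈ Set.Icc (0 : ℝ) 1 := by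
  have h0 : (0 : ℝ) < d := by exact_mod_cast i.pos
  have h1 : ((i : ℕ) + 1 : ℝ) ≤ d := by exact_mod_cast i.isLt
  exact ⟨by positivity, (div_le_one h0).2 h1⟩

/-- Every grid point of the block `j` is within `1 / k` of the corner `j / k`. -/
theorem abs_grid_sub_cluster_le {d k : ℕ} (hk : 1 ≤ k) (i : Fin d) :
    |((i : ℕ) + 1 : ℝ) / d - (cluster d k i : ℝ) / k| ≤ 1 / k := by
  have h0 : (0 : ℝ) < d := by exact_mod_cast i.pos
  have hk0 : (0 : ℝ) < k := by exact_mod_cast hk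
  have h1 : (k : ℝ) * ((i : ℕ) + 1) / d ≤ cluster d k i := Nat.le_ceil _
  have h2 : (cluster d k i : ℝ) < (k : ℝ) * ((i : ℕ) + 1) / d + 1 :=
    Nat.ceil_lt_add_one (by positivity)
  have e : ((i : ℕ) + 1 : ℝ) / d - (cluster d k i : ℝ) / k =
      ((k : ℝ) * ((i : ℕ) + 1) / d - cluster d k i) / k := by
    field_simp
  rw [e, abs_div, abs_of_pos hk0]
  gcongr
  rw [abs_le]
  constructor <;> linarith

/-- Local polynomial approximation within distance `1 / k`, used at the block corners `z / k`, gives a block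
polynomial approximation on the grid. -/
theorem exists_blockPoly_approx {m d k ℓ : ℕ} (hk : 1 ≤ k) {f : (Fin m → ℝ) → ℝ} {δ : ℝ}
    (h : ∀ x₀ ∈ unitCube m, ∃ P : MvPolynomial (Fin m) ℝ, P.totalDegree ≤ ℓ ∧
      ∀ x ∈ unitCube m, ‖x - x₀‖ ≤ 1 / k → |f x - MvPolynomial.eval (x - x₀) P| ≤ δ) :
    ∃ A ∈ blockPoly m d k ℓ, ∀ i, |gridTensor m d f i - A i| ≤ δ := by
  have hk0 : (0 : ℝ) < k := by exact_mod_cast hk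
  have h' : ∀ x₀ : Fin m → ℝ, ∃ P : MvPolynomial (Fin m) ℝ, P.totalDegree ≤ ℓ ∧
      (x₀ ∈ unitCube m → ∀ x ∈ unitCube m, ‖x - x₀‖ ≤ 1 / k →
        |f x - MvPolynomial.eval (x - x₀) P| ≤ δ) := by
    intro x₀
    by_cases hx : x₀ ∈ unitCube m
    · obtain ⟨P, h1, h2⟩ := h x₀ hx
      exact ⟨P, h1, fun _ => h2⟩
    · exact ⟨0, by simp, fun hx' => absurd hx' hx⟩
  choose P hP hf using h'
  let q : (Fin m → ℕ) → Fin m → MvPolynomial (Fin m) ℝ := fun j a =>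
    MvPolynomial.C (d : ℝ)⁻¹ * MvPolynomial.X a - MvPolynomial.C ((j a : ℝ) / k)
  have hq : ∀ j a, (q j a).totalDegree ≤ 1 := by
    intro j a
    refine (MvPolynomial.totalDegree_sub _ _).trans (max_le ?_ (by simp))
    exact (MvPolynomial.totalDegree_mul _ _).trans (by simp)
  refine ⟨_, ⟨fun j => MvPolynomial.bind₁ (q j) (P fun a => (j a : ℝ) / k),
    fun j => (totalDegree_bind₁_le _ (hq j) _).trans (hP _), fun i => rfl⟩, fun i => ?_⟩
  have hx₀ : (fun a => (cluster d k (i a) : ℝ) / k) ∈ unitCube m :=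
    ⟨fun a => by simp only [Pi.zero_apply]; positivity, fun a => (div_le_one hk0).2 (by
      exact_mod_cast cluster_le (i a))⟩
  have hx : (fun a => ((i a : ℕ) + 1 : ℝ) / d) ∈ unitCube m :=
    ⟨fun a => (grid_mem_Icc (i a)).1, fun a => (grid_mem_Icc (i a)).2⟩
  have := hf _ hx₀ _ hx ((pi_norm_le_iff_of_nonneg (by positivity)).2 fun a =>
    abs_grid_sub_cluster_le hk (i a))
  convert this using 2
  refine congrArg (f _ - ·) ?_
  rw [← MvPolynomial.coe_aeval_eq_eval, ← MvPolynomial.coe_aeval_eq_eval]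
  simp only [RingHom.coe_coe, MvPolynomial.aeval_bind₁]
  congr 2
  funext a
  simp [q, div_eq_inv_mul]

/-- The coefficients are linear functions of the values on a grid that is fine enough for evaluation to be
injective, hence bounded by these values. -/
theorem exists_sum_abs_coeff_le_of_grid {m n : ℕ} (S : Fin m → Finset ℝ)
    (hS : ∀ a, n < (S a).card) : ∃ K : ℝ, 0 ≤ K ∧ ∀ P : MvPolynomial (Fin m) ℝ,
      P.totalDegree ≤ n → ∀ M : ℝ, (∀ y : Fin m → ℝ, (∀ a, y a ∈ S a) →
        |MvPolynomial.eval y P| ≤ M) → ∑ s ∈ P.support, |P.coeff s| ≤ K * M := by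
  classical
  let ev : MvPolynomial.restrictTotalDegree (Fin m) ℝ n →ₗ[ℝ] (Fintype.piFinset S → ℝ) :=
    LinearMap.pi fun y => (MvPolynomial.aeval (y : Fin m → ℝ)).toLinearMap ∘ₗ
      (MvPolynomial.restrictTotalDegree (Fin m) ℝ n).subtype
  have hev : ∀ P y, ev P y = MvPolynomial.eval (y : Fin m → ℝ) (P : MvPolynomial (Fin m) ℝ) :=
    fun P y => by simp [ev]
  have hinj : LinearMap.ker ev = ⊥ := by
    refine LinearMap.ker_eq_bot'.2 fun P hP => Subtype.ext ?_
    refine MvPolynomial.eq_zero_of_eval_zero_at_prod_finset _ S (fun a => ?_) fun y hy => ?_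
    · exact ((MvPolynomial.degreeOf_le_totalDegree _ _).trans
        ((MvPolynomial.mem_restrictTotalDegree _ _ _).1 P.2)).trans_lt (hS a)
    · rw [← hev P ⟨y, Fintype.mem_piFinset.2 hy⟩, hP, Pi.zero_apply]
  obtain ⟨G, hG⟩ := ev.exists_leftInverse_of_injective hinj
  let Q : Fintype.piFinset S → MvPolynomial (Fin m) ℝ := fun y => (G (Pi.single y 1) : _)
  refine ⟨∑ y, ∑ s ∈ (Q y).support, |(Q y).coeff s|,
    Finset.sum_nonneg fun _ _ => Finset.sum_nonneg fun _ _ => abs_nonneg _, fun P hP M hM => ?_⟩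
  let P' : MvPolynomial.restrictTotalDegree (Fin m) ℝ n :=
    ⟨P, (MvPolynomial.mem_restrictTotalDegree _ _ _).2 hP⟩
  have hPQ : P = ∑ y, ev P' y • Q y := by
    have h1 : G (ev P') = P' := LinearMap.congr_fun hG P'
    rw [← (Pi.basisFun ℝ _).sum_repr (ev P'), map_sum] at h1
    simpa [P', Q] using (congrArg Subtype.val h1).symm
  have hc : ∀ s, |P.coeff s| ≤ ∑ y, M * |(Q y).coeff s| := by
    intro s
    conv_lhs => rw [hPQ]
    rw [MvPolynomial.coeff_sum]
    refine (Finset.abs_sum_le_sum_abs _ _).trans (Finset.sum_le_sum fun y _ => ?_)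
    rw [MvPolynomial.coeff_smul, smul_eq_mul, abs_mul, hev]
    gcongr
    exact hM y (Fintype.mem_piFinset.1 y.2)
  have hM0 : ∀ _y : Fintype.piFinset S, 0 ≤ M := fun y =>
    (abs_nonneg _).trans (hM y (Fintype.mem_piFinset.1 y.2))
  calc ∑ s ∈ P.support, |P.coeff s| ≤ ∑ s ∈ P.support, ∑ y, M * |(Q y).coeff s| :=
        Finset.sum_le_sum fun s _ => hc s
    _ = ∑ y, M * ∑ s ∈ P.support, |(Q y).coeff s| := by
        rw [Finset.sum_comm]; simp only [Finset.mul_sum]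
    _ ≤ ∑ y, M * ∑ s ∈ (Q y).support, |(Q y).coeff s| := by
        refine Finset.sum_le_sum fun y _ => mul_le_mul_of_nonneg_left ?_ (hM0 y)
        have h : ∑ s ∈ (Q y).support, |(Q y).coeff s| =
            ∑ s ∈ P.support ∪ (Q y).support, |(Q y).coeff s| :=
          Finset.sum_subset Finset.subset_union_right fun s _ hs => by
            rw [MvPolynomial.notMem_support_iff.1 hs, abs_zero]
        rw [h]
        exact Finset.sum_le_sum_of_subset_of_nonneg Finset.subset_union_left
          fun _ _ _ => abs_nonneg _
    _ = _ := by rw [← Finset.mul_sum, mul_comm]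

/-- The coefficients of a polynomial of degree at most `n` in `x - x₀` are bounded by its values on the cube,
with a constant that does not depend on the base point `x₀`. -/
theorem exists_sum_abs_coeff_le (m n : ℕ) : ∃ K : ℝ, 0 ≤ K ∧ ∀ P : MvPolynomial (Fin m) ℝ,
    P.totalDegree ≤ n → ∀ x₀ ∈ unitCube m, ∀ M : ℝ,
      (∀ x ∈ unitCube m, |MvPolynomial.eval (x - x₀) P| ≤ M) →
      ∑ s ∈ P.support, |P.coeff s| ≤ K * M := by
  classical
  let S : (Fin m → Bool) → Fin m → Finset ℝ := fun b a =>
    (Finset.range (n + 1)).image fun t : ℕ => (if b a then 1 else -1) * ((t : ℝ) / (2 * (n + 1)))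
  have hS : ∀ b a, n < (S b a).card := by
    intro b a
    rw [Finset.card_image_of_injective, Finset.card_range]
    · exact n.lt_succ_self
    · intro t t' h
      have h1 : (t : ℝ) / (2 * (n + 1)) = t' / (2 * (n + 1)) := by
        refine mul_left_cancel₀ (a := if b a then (1 : ℝ) else -1) ?_ h
        split_ifs <;> norm_num
      have h2 : (2 * (n + 1) : ℝ) ≠ 0 := by positivity
      exact_mod_cast (div_left_inj' h2).1 h1
  choose K hK0 hK using fun b => exists_sum_abs_coeff_le_of_grid (S b) (hS b)
  refine ⟨∑ b, K b, Finset.sum_nonneg fun b _ => hK0 b, fun P hP x₀ hx₀ M hM => ?_⟩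
  -- In each coordinate, step away from `x₀` in a direction in which the cube has length `1/2`.
  let b : Fin m → Bool := fun a => decide (x₀ a ≤ 1 / 2)
  have hM0 : 0 ≤ M := (abs_nonneg _).trans (hM x₀ hx₀)
  have h := hK b P hP M fun y hy => by
    have hy' : x₀ + y ∈ unitCube m := by
      have key : ∀ a, 0 ≤ x₀ a + y a ∧ x₀ a + y a ≤ 1 := by
        intro a
        obtain ⟨t, ht, hty⟩ := Finset.mem_image.1 (hy a)
        have ht1 : (t : ℝ) ≤ n := by exact_mod_cast Nat.lt_succ_iff.1 (Finset.mem_range.1 ht)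
        have ht2 : (t : ℝ) / (2 * (n + 1)) ≤ 1 / 2 := by
          rw [div_le_div_iff₀ (by positivity) (by norm_num)]; linarith
        have ht3 : 0 ≤ (t : ℝ) / (2 * (n + 1)) := by positivity
        have h0 := hx₀.1 a
        have h1 := hx₀.2 a
        simp only [Pi.zero_apply, Pi.one_apply] at h0 h1
        rw [← hty]
        by_cases hb : x₀ a ≤ 1 / 2
        · simp only [b, hb, decide_true, if_true]
          constructor <;> linarith
        · simp only [b, hb, decide_false, Bool.false_eq_true, if_false]
          push Not at hb
          constructor <;> linarith
      exact ⟨fun a => (key a).1, fun a => (key a).2⟩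
    simpa using hM _ hy'
  exact h.trans (mul_le_mul_of_nonneg_right
    (Finset.single_le_sum (fun b _ => hK0 b) (Finset.mem_univ b)) hM0)

/-- Dropping the terms of degree above `ℓ` costs at most `‖y‖ ^ (ℓ + 1)` times the sum of the absolute values of
the coefficients. -/
theorem exists_truncation {m : ℕ} (ℓ : ℕ) (P : MvPolynomial (Fin m) ℝ) :
    ∃ Q : MvPolynomial (Fin m) ℝ, Q.totalDegree ≤ ℓ ∧ ∀ y : Fin m → ℝ, ‖y‖ ≤ 1 →
      |MvPolynomial.eval y P - MvPolynomial.eval y Q| ≤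
        (∑ s ∈ P.support, |P.coeff s|) * ‖y‖ ^ (ℓ + 1) := by
  classical
  refine ⟨∑ s ∈ P.support with s.degree ≤ ℓ, MvPolynomial.monomial s (P.coeff s),
    MvPolynomial.totalDegree_finsetSum_le fun s hs => ?_, fun y hy => ?_⟩
  · refine (MvPolynomial.totalDegree_monomial_le _ _).trans ?_
    exact (Finset.mem_filter.1 hs).2
  · have e : MvPolynomial.eval y P -
        MvPolynomial.eval y (∑ s ∈ P.support with s.degree ≤ ℓ,
          MvPolynomial.monomial s (P.coeff s)) =
        ∑ s ∈ P.support with ¬ s.degree ≤ ℓ, P.coeff s * ∏ a, y a ^ s a := by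
      rw [MvPolynomial.eval_eq', map_sum, sub_eq_iff_eq_add',
        ← Finset.sum_filter_add_sum_filter_not _ (fun s : Fin m →₀ ℕ => s.degree ≤ ℓ)]
      congr 1
      refine Finset.sum_congr rfl fun s _ => ?_
      rw [MvPolynomial.eval_monomial, Finsupp.prod_fintype _ _ (by simp)]
    rw [e, Finset.sum_mul]
    refine (Finset.abs_sum_le_sum_abs _ _).trans ?_
    refine le_trans (Finset.sum_le_sum fun s hs => ?_)
      (Finset.sum_le_sum_of_subset_of_nonneg (Finset.filter_subset _ _) fun s _ _ => by positivity)
    rw [abs_mul]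
    gcongr
    rw [Finset.abs_prod]
    calc ∏ a, |y a ^ s a| ≤ ∏ a, ‖y‖ ^ s a :=
          Finset.prod_le_prod (fun _ _ => abs_nonneg _) fun a _ => by
            rw [abs_pow]; gcongr; exact norm_le_pi_norm y a
      _ = ‖y‖ ^ s.degree := by rw [Finset.prod_pow_eq_pow_sum, Finsupp.degree_eq_sum]
      _ ≤ ‖y‖ ^ (ℓ + 1) := pow_le_pow_of_le_one (norm_nonneg y) hy
          (not_le.1 (Finset.mem_filter.1 hs).2)

theorem exists_blockPoly_approx_of_holder {m d k ℓ : ℕ} {α L : ℝ} (hα : 0 ≤ α) (hL : 0 ≤ L)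
    (hk : 1 ≤ k) (hℓ : ⌊α⌋₊ ≤ ℓ) {f : (Fin m → ℝ) → ℝ} (hf : f ∈ holderClass m α L) :
    ∃ A ∈ blockPoly m d k ℓ, ∀ i,
      |gridTensor m d f i - A i| ≤ L * (1 / (k : ℝ)) ^ min α (ℓ + 1) := by
  have hmin : min α ((ℓ : ℝ) + 1) = α := min_eq_left <|
    (Nat.lt_floor_add_one α).le.trans (by exact_mod_cast Nat.succ_le_succ hℓ)
  rw [hmin]
  refine exists_blockPoly_approx hk fun x₀ hx₀ => ?_
  obtain ⟨P, hP, hPf⟩ := hf x₀ hx₀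
  refine ⟨P, hP.trans hℓ, fun x hx hxx => (hPf x hx).trans ?_⟩
  gcongr

theorem exists_blockPoly_approx_of_holder_of_bounded (m : ℕ) {α L : ℝ} (hα : 0 ≤ α) (hL : 0 < L)
    (B : ℝ) : ∃ D : ℝ, 0 < D ∧ ∀ d k ℓ : ℕ, 1 ≤ k → ∀ f ∈ holderClass m α L ∩ boundedBy m B,
      ∃ A ∈ blockPoly m d k ℓ, ∀ i,
        |gridTensor m d f i - A i| ≤ D * (1 / (k : ℝ)) ^ min α (ℓ + 1) := by
  obtain ⟨K, hK0, hK⟩ := exists_sum_abs_coeff_le m ⌊α⌋₊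
  refine ⟨L + K * (|B| + L), by positivity, fun d k ℓ hk f hf => ?_⟩
  have hk0 : (0 : ℝ) < k := by exact_mod_cast hk
  have hk1 : 1 / (k : ℝ) ≤ 1 := (div_le_one hk0).2 (by exact_mod_cast hk)
  rcases le_or_gt ⌊α⌋₊ ℓ with hℓ | hℓ
  · obtain ⟨A, hA, h⟩ := exists_blockPoly_approx_of_holder (d := d) hα hL.le hk hℓ hf.1
    refine ⟨A, hA, fun i => (h i).trans ?_⟩
    gcongr
    exact le_add_of_nonneg_right (by positivity)
  have hℓα : (ℓ : ℝ) + 1 ≤ α :=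
    (by exact_mod_cast hℓ : (ℓ : ℝ) + 1 ≤ ⌊α⌋₊).trans (Nat.floor_le hα)
  rw [min_eq_right hℓα]
  refine exists_blockPoly_approx hk fun x₀ hx₀ => ?_
  obtain ⟨P, hP, hPf⟩ := hf.1 x₀ hx₀
  obtain ⟨Q, hQ, hPQ⟩ := exists_truncation ℓ P
  refine ⟨Q, hQ, fun x hx hxx => ?_⟩
  have hdist : ∀ z ∈ unitCube m, ‖z - x₀‖ ≤ 1 := by
    intro z hz
    refine (pi_norm_le_iff_of_nonneg zero_le_one).2 fun a => ?_
    have h1 := hz.1 a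
    have h2 := hz.2 a
    have h3 := hx₀.1 a
    have h4 := hx₀.2 a
    simp only [Pi.zero_apply, Pi.one_apply] at h1 h2 h3 h4
    rw [Pi.sub_apply, Real.norm_eq_abs, abs_le]
    constructor <;> linarith
  have hbd : ∀ z ∈ unitCube m, |MvPolynomial.eval (z - x₀) P| ≤ |B| + L := by
    intro z hz
    have h1 := hPf z hz
    have h2 := hf.2 z hz
    have h3 : L * ‖z - x₀‖ ^ α ≤ L * 1 :=
      mul_le_mul_of_nonneg_left (Real.rpow_le_one (norm_nonneg _) (hdist z hz) hα) hL.le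
    have h4 := abs_sub_abs_le_abs_sub (MvPolynomial.eval (z - x₀) P) (f z)
    rw [abs_sub_comm] at h4
    linarith [le_abs_self B]
  have hsum := hK P hP x₀ hx₀ _ hbd
  have h1 : |f x - MvPolynomial.eval (x - x₀) P| ≤ L * (1 / (k : ℝ)) ^ ((ℓ : ℝ) + 1) := by
    refine (hPf x hx).trans ?_
    gcongr
    exact (Real.rpow_le_rpow (norm_nonneg _) hxx hα).trans
      (Real.rpow_le_rpow_of_exponent_ge (by positivity) hk1 hℓα)
  have h2 : |MvPolynomial.eval (x - x₀) P - MvPolynomial.eval (x - x₀) Q| ≤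
      K * (|B| + L) * (1 / (k : ℝ)) ^ ((ℓ : ℝ) + 1) := by
    refine (hPQ _ (hdist x hx)).trans ?_
    have : (1 / (k : ℝ)) ^ ((ℓ : ℝ) + 1) = (1 / (k : ℝ)) ^ (ℓ + 1) := by
      rw [← Real.rpow_natCast]; push_cast; rfl
    rw [this]
    gcongr
  have h3 := abs_add_le (f x - MvPolynomial.eval (x - x₀) P)
    (MvPolynomial.eval (x - x₀) P - MvPolynomial.eval (x - x₀) Q)
  rw [sub_add_sub_cancel] at h3
  linarith

/-! ### Rates and tuning -/

theorem LSEErrorBound.mono {m d : ℕ} {𝒯 : Set (Tensor m d)} {σ R R' : ℝ} {k ℓ : ℕ} {ε ε' : ℝ≥0∞}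
    (h : LSEErrorBound.{u} 𝒯 σ k ℓ R ε) (hR : R ≤ R') (hε : ε ≤ ε') :
    LSEErrorBound.{u} 𝒯 σ k ℓ R' ε' := by
  intro Θ hΘ π Ω _ μ _ E hE Θ' π' hLSE
  exact (measure_mono fun w hw => lt_of_le_of_lt hR hw).trans
    ((h Θ hΘ π Ω μ E hE Θ' π' hLSE).trans hε)

theorem eventually_ofReal_inv_natCast_le {ε : ℝ≥0∞} (hε : 0 < ε) :
    ∀ᶠ d : ℕ in atTop, ENNReal.ofReal (d : ℝ)⁻¹ ≤ ε := by
  have h : Tendsto (fun d : ℕ => ENNReal.ofReal (d : ℝ)⁻¹) atTop (nhds 0) := by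
    simpa using ENNReal.tendsto_ofReal (tendsto_inv_atTop_nhds_zero_nat (𝕜 := ℝ))
  exact (h.eventually_lt_const hε).mono fun _ => le_of_lt

theorem sq_mul_rpow_one_div (D p : ℝ) (k : ℕ) :
    (D * (1 / (k : ℝ)) ^ p) ^ 2 = D ^ 2 / (k : ℝ) ^ (2 * p) := by
  rw [mul_pow, Real.div_rpow zero_le_one (Nat.cast_nonneg k), Real.one_rpow, div_pow, one_pow,
    mul_comm 2 p, Real.rpow_mul (Nat.cast_nonneg k), Real.rpow_two, mul_one_div]

theorem lseErrorBound_holder {m d k ℓ : ℕ} {α L σ : ℝ} (hm : 1 ≤ m) (hd : 1 ≤ d) (hk : 1 ≤ k)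
    (hα : 0 ≤ α) (hL : 0 ≤ L) (hσ : 0 < σ) (hℓ : ⌊α⌋₊ ≤ ℓ) :
    LSEErrorBound.{u} (smoothTensors d (holderClass m α L)) σ k ℓ
      (64 * lseRate m α L σ d k ℓ) (ENNReal.ofReal (d : ℝ)⁻¹) := by
  refine (LSEErrorBound.of_approx hm hd hσ hk (δ := L * (1 / (k : ℝ)) ^ min α ((ℓ : ℝ) + 1))
    ?_).mono ?_ le_rfl
  · rintro _ ⟨f, hf, rfl⟩
    exact exists_blockPoly_approx_of_holder hα hL hk hℓ hf
  · rw [sq_mul_rpow_one_div, lseRate, mul_add 64]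
    gcongr
    norm_num

theorem exists_lseErrorBound_holder_of_bounded {m : ℕ} (hm : 1 ≤ m) {α L : ℝ} (hα : 0 ≤ α)
    (hL : 0 < L) (B : ℝ) : ∃ D : ℝ, 0 < D ∧ ∀ σ : ℝ, 0 < σ → ∀ d k ℓ : ℕ, 1 ≤ d → 1 ≤ k →
      LSEErrorBound.{u} (smoothTensors d (holderClass m α L ∩ boundedBy m B)) σ k ℓ
        (D * (L ^ 2 / (k : ℝ) ^ (2 * min α (ℓ + 1))) +
          64 * (σ ^ 2 * ((k : ℝ) ^ m * ((ℓ : ℝ) + m) ^ ℓ / (d : ℝ) ^ m +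
            Real.log d / (d : ℝ) ^ (m - 1)))) (ENNReal.ofReal (d : ℝ)⁻¹) := by
  obtain ⟨D, hD, h⟩ := exists_blockPoly_approx_of_holder_of_bounded m hα hL B
  refine ⟨18 * D ^ 2 / L ^ 2, by positivity, fun σ hσ d k ℓ hd hk => ?_⟩
  refine (LSEErrorBound.of_approx hm hd hσ hk (δ := D * (1 / (k : ℝ)) ^ min α ((ℓ : ℝ) + 1))
    ?_).mono (le_of_eq ?_) le_rfl
  · rintro _ ⟨f, hf, rfl⟩
    exact h d k ℓ hk f hf
  · rw [sq_mul_rpow_one_div]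
    field_simp

/-- The common order `L² (dᵐ L² / σ²) ^ (-2p / (m + 2p))` of the first two terms of the error bound
when the approximation exponent is `p` and the number of blocks is tuned to balance them. -/
noncomputable def balancedRate (m : ℕ) (p L σ : ℝ) (d : ℕ) : ℝ :=
  L ^ 2 * (σ / L) ^ (4 * p / (m + 2 * p)) * (d : ℝ) ^ (-(2 * m * p / (m + 2 * p)))

theorem balancedRate_eq {m d : ℕ} {p L σ : ℝ} (hL : 0 < L) (hσ : 0 < σ) (hd : 1 ≤ d) :
    balancedRate m p L σ d =
      L ^ 2 * ((d : ℝ) ^ m * L ^ 2 / σ ^ 2) ^ (-(2 * p / (m + 2 * p))) := by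
  have h0 : (0 : ℝ) < d := by exact_mod_cast hd
  have e : (d : ℝ) ^ m * L ^ 2 / σ ^ 2 = (d : ℝ) ^ (m : ℝ) * (σ / L) ^ (-2 : ℝ) := by
    rw [Real.rpow_neg (by positivity), Real.rpow_natCast, Real.rpow_two]
    field_simp
  rw [balancedRate, e, Real.mul_rpow (by positivity) (by positivity), ← Real.rpow_mul h0.le,
    ← Real.rpow_mul (by positivity), mul_assoc, mul_comm ((d : ℝ) ^ _)]
  congr 3 <;> ring_nf

theorem one_le_blockStar {m d : ℕ} {α L σ : ℝ} (hL : 0 < L) (hσ : 0 < σ) (hd : 1 ≤ d) :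
    1 ≤ blockStar m α L σ d := by
  have h0 : (0 : ℝ) < d := by exact_mod_cast hd
  exact Nat.ceil_pos.2 (by positivity)

theorem bias_blockStar_le {m d : ℕ} {α L σ p : ℝ} (hm : 1 ≤ m) (hα : 0 ≤ α) (hL : 0 < L)
    (hσ : 0 < σ) (hd : 1 ≤ d) (hp : min α ((degStar m α : ℝ) + 1) = p) :
    L ^ 2 / (blockStar m α L σ d : ℝ) ^ (2 * p) ≤ balancedRate m p L σ d := by
  have h0 : (0 : ℝ) < d := by exact_mod_cast hd
  have hm0 : (0 : ℝ) < m := by exact_mod_cast hm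
  have hp0 : 0 ≤ p := hp ▸ le_min hα (by positivity)
  rw [balancedRate_eq hL hσ hd, blockStar, hp, div_eq_mul_inv]
  set X := (d : ℝ) ^ m * L ^ 2 / σ ^ 2
  have hX : 0 < X := by positivity
  gcongr
  calc ((⌈X ^ (1 / ((m : ℝ) + 2 * p))⌉₊ : ℝ) ^ (2 * p))⁻¹
      ≤ ((X ^ (1 / ((m : ℝ) + 2 * p))) ^ (2 * p))⁻¹ := by
        gcongr
        exact Nat.le_ceil _
    _ = X ^ (-(2 * p / (m + 2 * p))) := by
        rw [← Real.rpow_mul hX.le, ← Real.rpow_neg hX.le]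
        congr 1
        ring

theorem variance_blockStar_le {m d : ℕ} {α L σ p : ℝ} (hm : 1 ≤ m) (hα : 0 ≤ α) (hL : 0 < L)
    (hσ : 0 < σ) (hd : 1 ≤ d) (hX : σ ^ 2 / L ^ 2 ≤ d)
    (hp : min α ((degStar m α : ℝ) + 1) = p) :
    σ ^ 2 * ((blockStar m α L σ d : ℝ) ^ m / (d : ℝ) ^ m) ≤ 2 ^ m * balancedRate m p L σ d := by
  have h0 : (0 : ℝ) < d := by exact_mod_cast hd
  have hm0 : (0 : ℝ) < m := by exact_mod_cast hm
  have hp0 : 0 ≤ p := hp ▸ le_min hα (by positivity)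
  rw [balancedRate_eq hL hσ hd, blockStar, hp]
  have hX1 : 1 ≤ (d : ℝ) ^ m * L ^ 2 / σ ^ 2 := by
    rw [le_div_iff₀ (by positivity), one_mul]
    rw [div_le_iff₀ (by positivity)] at hX
    refine hX.trans ?_
    gcongr
    exact le_self_pow₀ (by exact_mod_cast hd) (by omega)
  have hXe : σ ^ 2 = (d : ℝ) ^ m * L ^ 2 / ((d : ℝ) ^ m * L ^ 2 / σ ^ 2) := by field_simp
  set X := (d : ℝ) ^ m * L ^ 2 / σ ^ 2
  have hX0 : 0 < X := by positivity
  have hy : 1 ≤ X ^ (1 / ((m : ℝ) + 2 * p)) := Real.one_le_rpow hX1 (by positivity)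
  have hk : (⌈X ^ (1 / ((m : ℝ) + 2 * p))⌉₊ : ℝ) ≤ 2 * X ^ (1 / ((m : ℝ) + 2 * p)) := by
    linarith [Nat.ceil_lt_add_one (zero_le_one.trans hy)]
  calc σ ^ 2 * ((⌈X ^ (1 / ((m : ℝ) + 2 * p))⌉₊ : ℝ) ^ m / (d : ℝ) ^ m)
      ≤ σ ^ 2 * ((2 * X ^ (1 / ((m : ℝ) + 2 * p))) ^ m / (d : ℝ) ^ m) := by gcongr
    _ = 2 ^ m * (L ^ 2 * (X ^ (m / ((m : ℝ) + 2 * p)) / X)) := by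
        rw [hXe, mul_pow, ← Real.rpow_natCast (X ^ _) m, ← Real.rpow_mul hX0.le,
          one_div_mul_eq_div]
        field_simp
    _ = 2 ^ m * (L ^ 2 * X ^ (-(2 * p / (m + 2 * p)))) := by
        rw [← Real.rpow_sub_one hX0.ne']
        congr 3
        field_simp
        ring

/-- Below the critical exponent the cost of the unknown permutation is negligible. -/
theorem eventually_log_div_pow_le_balancedRate {m : ℕ} (hm : 2 ≤ m) {p L σ : ℝ} (hp : 0 ≤ p)
    (hL : 0 < L) (hσ : 0 < σ) (h : p < (m : ℝ) * (m - 1) / 2) :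
    ∀ᶠ d : ℕ in atTop, σ ^ 2 * (Real.log d / (d : ℝ) ^ (m - 1)) ≤ balancedRate m p L σ d := by
  have hm0 : (0 : ℝ) < m := by exact_mod_cast (by omega : 0 < m)
  set q : ℝ := 2 * m * p / (m + 2 * p)
  have hq : q < m - 1 := by
    rw [div_lt_iff₀ (by positivity)]
    nlinarith
  set c : ℝ := L ^ 2 * (σ / L) ^ (4 * p / (m + 2 * p))
  have hc : 0 < c := by positivity
  filter_upwards [((isLittleO_log_rpow_atTop (sub_pos.2 hq)).comp_tendsto
    tendsto_natCast_atTop_atTop).bound (by positivity : 0 < c / σ ^ 2),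
    eventually_ge_atTop 1] with d hd hd1
  have h0 : (0 : ℝ) < d := by exact_mod_cast hd1
  have hd2 : Real.log d ≤ c / σ ^ 2 * (d : ℝ) ^ ((m : ℝ) - 1 - q) := by
    refine (le_abs_self _).trans (hd.trans_eq ?_)
    rw [Function.comp_apply, Real.norm_of_nonneg (by positivity)]
  have e : (d : ℝ) ^ (m - 1) = (d : ℝ) ^ ((m : ℝ) - 1) := by
    rw [← Real.rpow_natCast, Nat.cast_sub (by omega), Nat.cast_one]
  calc σ ^ 2 * (Real.log d / (d : ℝ) ^ (m - 1))
      ≤ σ ^ 2 * (c / σ ^ 2 * (d : ℝ) ^ ((m : ℝ) - 1 - q) / (d : ℝ) ^ (m - 1)) := by gcongr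
    _ = c * ((d : ℝ) ^ ((m : ℝ) - 1 - q) / (d : ℝ) ^ ((m : ℝ) - 1)) := by
        rw [e]; field_simp
    _ = balancedRate m p L σ d := by
        rw [← Real.rpow_sub h0, balancedRate]
        congr 2
        ring

/-- At the critical exponent the balanced rate is `d ^ (-(m - 1))`, and `log d` absorbs any constant. -/
theorem eventually_balancedRate_le_log {m : ℕ} (hm : 2 ≤ m) {σ : ℝ} (hσ : 0 < σ)
    (L K : ℝ) : ∀ᶠ d : ℕ in atTop, K * balancedRate m ((m : ℝ) * (m - 1) / 2) L σ d ≤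
      σ ^ 2 * (Real.log d / (d : ℝ) ^ (m - 1)) := by
  have hm0 : (0 : ℝ) < m := by exact_mod_cast (by omega : 0 < m)
  set c : ℝ := L ^ 2 * (σ / L) ^ (4 * ((m : ℝ) * (m - 1) / 2) / (m + 2 * ((m : ℝ) * (m - 1) / 2)))
  filter_upwards [(Real.tendsto_log_atTop.comp tendsto_natCast_atTop_atTop).eventually_ge_atTop
    (K * c / σ ^ 2), eventually_ge_atTop 1] with d hd hd1
  have h0 : (0 : ℝ) < d := by exact_mod_cast hd1
  have hq : 2 * m * ((m : ℝ) * (m - 1) / 2) / (m + 2 * ((m : ℝ) * (m - 1) / 2)) =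
      ((m - 1 : ℕ) : ℝ) := by
    have h1 : (m : ℝ) + 2 * ((m : ℝ) * (m - 1) / 2) = m ^ 2 := by ring
    rw [h1, Nat.cast_sub (by omega), Nat.cast_one]
    field_simp
  have hb : balancedRate m ((m : ℝ) * (m - 1) / 2) L σ d = c / (d : ℝ) ^ (m - 1) := by
    rw [balancedRate, hq, Real.rpow_neg h0.le, Real.rpow_natCast, ← div_eq_mul_inv]
  rw [hb, ← mul_div_assoc, ← mul_div_assoc]
  refine div_le_div_of_nonneg_right ?_ (by positivity)
  rw [mul_comm (σ ^ 2)]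
  exact (div_le_iff₀ (by positivity)).1 hd

theorem degree_bound_add_one {m : ℕ} (hm : 2 ≤ m) :
    (m - 2) * (m + 1) / 2 + 1 = m * (m - 1) / 2 := by
  obtain ⟨n, rfl⟩ := Nat.exists_eq_add_of_le hm
  have h : (2 + n) * (2 + n - 1) = n * (2 + n + 1) + 2 := by
    rw [show 2 + n - 1 = n + 1 by omega]; ring
  rw [h, Nat.add_sub_cancel_left, Nat.add_div_right _ two_pos]

theorem cast_degree_bound_add_one {m : ℕ} (hm : 2 ≤ m) :
    (((m - 2) * (m + 1) / 2 : ℕ) : ℝ) + 1 = (m : ℝ) * (m - 1) / 2 := by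
  have h : (((m - 2) * (m + 1) / 2 + 1 : ℕ) : ℝ) = (m : ℝ) * (m - 1) / 2 := by
    rw [degree_bound_add_one hm, Nat.cast_div (Nat.even_mul_pred_self m).two_dvd two_ne_zero,
      Nat.cast_mul, Nat.cast_sub (by omega), Nat.cast_one, Nat.cast_two]
  rw [← h, Nat.cast_add, Nat.cast_one]

/-- Below the critical smoothness, `(m - 2)(m + 1)/2 + 1 = m (m - 1)/2` makes the cap in `ℓ*` inactive. -/
theorem degStar_of_lt {m : ℕ} (hm : 2 ≤ m) {α : ℝ} (hα : 0 ≤ α)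
    (h : α < (m : ℝ) * (m - 1) / 2) : degStar m α = ⌊α⌋₊ := by
  refine min_eq_left (Nat.lt_succ_iff.1 ((Nat.floor_lt hα).2 ?_))
  rw [Nat.cast_succ, cast_degree_bound_add_one hm]
  exact h

theorem min_degStar_add_one_of_ge {m : ℕ} (hm : 2 ≤ m) {α : ℝ}
    (h : (m : ℝ) * (m - 1) / 2 ≤ α) :
    min α ((degStar m α : ℝ) + 1) = (m : ℝ) * (m - 1) / 2 := by
  have h1 : (m - 2) * (m + 1) / 2 ≤ ⌊α⌋₊ := Nat.le_floor (by
    linarith [cast_degree_bound_add_one hm])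
  rw [degStar, min_eq_right h1, cast_degree_bound_add_one hm, min_eq_right h]

theorem eventually_div_sq_le (L σ : ℝ) : ∀ᶠ d : ℕ in atTop, σ ^ 2 / L ^ 2 ≤ d :=
  tendsto_natCast_atTop_atTop.eventually_ge_atTop _

theorem theorem1 (m : ℕ) (hm : 2 ≤ m) (α : ℝ) (hα : 0 ≤ α) :
    -- every `k ≤ d` and every degree `ℓ ≥ ⌊α⌋`, uniformly over the whole smooth class
    (∃ C : ℝ, 0 < C ∧ ∀ L σ : ℝ, 0 < L → 0 < σ →
      ∀ ε : ℝ≥0∞, 0 < ε → ∀ᶠ d : ℕ in atTop, ∀ k ℓ : ℕ, 1 ≤ k → k ≤ d → ⌊α⌋₊ ≤ ℓ →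
        LSEErrorBound.{u} (smoothTensors d (holderClass m α L)) σ k ℓ
          (C * lseRate m α L σ d k ℓ) ε) ∧
    -- every `k ≤ d` and every degree `ℓ`; the constant may depend on a bound on the function
    (∀ L B : ℝ, 0 < L → ∃ C : ℝ, 0 < C ∧ ∀ σ : ℝ, 0 < σ →
      ∀ ε : ℝ≥0∞, 0 < ε → ∀ᶠ d : ℕ in atTop, ∀ k ℓ : ℕ, 1 ≤ k → k ≤ d →
        LSEErrorBound.{u} (smoothTensors d (holderClass m α L ∩ boundedBy m B)) σ k ℓ
          (C * lseRate m α L σ d k ℓ) ε) ∧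
    -- the tuned rate below the critical smoothness
    (α < (m : ℝ) * (m - 1) / 2 →
      ∃ C : ℝ, 0 < C ∧ ∀ L σ : ℝ, 0 < L → 0 < σ →
        (∀ᶠ d : ℕ in atTop,
          lseRate m α L σ d (blockStar m α L σ d) (degStar m α) ≤
            C * (L ^ 2 * (σ / L) ^ (4 * α / (m + 2 * α))) *
              (d : ℝ) ^ (-(2 * m * α / (m + 2 * α)))) ∧
        ∀ ε : ℝ≥0∞, 0 < ε → ∀ᶠ d : ℕ in atTop,
          LSEErrorBound.{u} (smoothTensors d (holderClass m α L)) σ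
            (blockStar m α L σ d) (degStar m α)
            (C * (L ^ 2 * (σ / L) ^ (4 * α / (m + 2 * α))) *
              (d : ℝ) ^ (-(2 * m * α / (m + 2 * α)))) ε) ∧
    -- the tuned rate at and above the critical smoothness
    ((m : ℝ) * (m - 1) / 2 ≤ α →
      ∃ C : ℝ, 0 < C ∧ ∀ L σ : ℝ, 0 < L → 0 < σ →
        (∀ᶠ d : ℕ in atTop,
          lseRate m α L σ d (blockStar m α L σ d) (degStar m α) ≤
            C * σ ^ 2 * (d : ℝ) ^ (-((m : ℝ) - 1)) * Real.log d) ∧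
        ∀ B : ℝ, ∀ ε : ℝ≥0∞, 0 < ε → ∀ᶠ d : ℕ in atTop,
          LSEErrorBound.{u} (smoothTensors d (holderClass m α L ∩ boundedBy m B)) σ
            (blockStar m α L σ d) (degStar m α)
            (C * σ ^ 2 * (d : ℝ) ^ (-((m : ℝ) - 1)) * Real.log d) ε) := by
  have hm1 : 1 ≤ m := by omega
  refine ⟨⟨64, by norm_num, fun L σ hL hσ ε hε => ?_⟩, fun L B hL => ?_, fun hlt => ?_,
    fun hge => ?_⟩
  · filter_upwards [eventually_ofReal_inv_natCast_le hε, eventually_ge_atTop 1]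
      with d hd hd1 k ℓ hk _ hℓ
    exact (lseErrorBound_holder hm1 hd1 hk hα hL.le hσ hℓ).mono le_rfl hd
  · obtain ⟨D, hD, h⟩ := exists_lseErrorBound_holder_of_bounded.{u} hm1 hα hL B
    refine ⟨max D 64, lt_max_of_lt_left hD, fun σ hσ ε hε => ?_⟩
    filter_upwards [eventually_ofReal_inv_natCast_le hε, eventually_ge_atTop 1]
      with d hd hd1 k ℓ hk _
    refine (h σ hσ d k ℓ hd1 hk).mono ?_ hd
    have hlog : 0 ≤ Real.log d := Real.log_natCast_nonneg d
    rw [lseRate, mul_add (max D 64)]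
    gcongr
    · exact le_max_left _ _
    · exact le_max_right _ _
  · have hdeg := degStar_of_lt hm hα hlt
    have hmin : min α ((degStar m α : ℝ) + 1) = α := by
      rw [hdeg]
      exact min_eq_left (Nat.lt_floor_add_one α).le
    set c : ℝ := ((degStar m α : ℝ) + m) ^ degStar m α
    have hc : 0 ≤ c := by positivity
    have hrate : ∀ L σ : ℝ, 0 < L → 0 < σ → ∀ᶠ d : ℕ in atTop,
        lseRate m α L σ d (blockStar m α L σ d) (degStar m α) ≤
          (2 + 2 ^ m * c) * balancedRate m α L σ d := by
      intro L σ hL hσ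
      filter_upwards [eventually_ge_atTop 1, eventually_div_sq_le L σ,
        eventually_log_div_pow_le_balancedRate hm hα hL hσ hlt] with d hd hX hlog
      have h1 := bias_blockStar_le hm1 hα hL hσ hd hmin
      have h2 := mul_le_mul_of_nonneg_right (variance_blockStar_le hm1 hα hL hσ hd hX hmin) hc
      rw [lseRate, hmin, mul_add, mul_div_right_comm, ← mul_assoc]
      linarith
    have hG : ∀ L σ : ℝ, 0 < L → 0 < σ → ∀ d, 0 ≤ balancedRate m α L σ d := fun L σ hL hσ d => by
      rw [balancedRate]; positivity
    refine ⟨64 * (2 + 2 ^ m * c), by positivity, fun L σ hL hσ => ⟨?_, fun ε hε => ?_⟩⟩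
    · filter_upwards [hrate L σ hL hσ] with d hd
      rw [mul_assoc _ (L ^ 2 * _)]
      refine hd.trans (mul_le_mul_of_nonneg_right ?_ (hG L σ hL hσ d))
      linarith [(by positivity : 0 ≤ 2 + 2 ^ m * c)]
    · filter_upwards [hrate L σ hL hσ, eventually_ofReal_inv_natCast_le hε,
        eventually_ge_atTop 1] with d hd hdε hd1
      rw [mul_assoc _ (L ^ 2 * _), mul_assoc 64]
      exact (lseErrorBound_holder hm1 hd1 (one_le_blockStar hL hσ hd1) hα hL.le hσ
        hdeg.ge).mono (mul_le_mul_of_nonneg_left hd (by norm_num)) hdε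
  · have hmin := min_degStar_add_one_of_ge hm hge
    set c : ℝ := ((degStar m α : ℝ) + m) ^ degStar m α
    have hc : 0 ≤ c := by positivity
    have htarget : ∀ σ : ℝ, ∀ d : ℕ, 65 * σ ^ 2 * (d : ℝ) ^ (-((m : ℝ) - 1)) * Real.log d =
        65 * (σ ^ 2 * (Real.log d / (d : ℝ) ^ (m - 1))) := by
      intro σ d
      rw [Real.rpow_neg (Nat.cast_nonneg d), ← Nat.cast_one, ← Nat.cast_sub hm1, Real.rpow_natCast]
      ring
    -- The bias constant `K` may depend on `L` and the bound on the function: the logarithm absorbs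
    -- it for large `d`.
    have hrate : ∀ L σ K : ℝ, 0 < L → 0 < σ → 0 < K → ∀ᶠ d : ℕ in atTop,
        K * (L ^ 2 / (blockStar m α L σ d : ℝ) ^ (2 * min α ((degStar m α : ℝ) + 1))) +
          64 * (σ ^ 2 * ((blockStar m α L σ d : ℝ) ^ m * c / (d : ℝ) ^ m +
            Real.log d / (d : ℝ) ^ (m - 1))) ≤
          65 * σ ^ 2 * (d : ℝ) ^ (-((m : ℝ) - 1)) * Real.log d := by
      intro L σ K hL hσ hK
      filter_upwards [eventually_ge_atTop 1, eventually_div_sq_le L σ,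
        eventually_balancedRate_le_log hm hσ L (K + 64 * 2 ^ m * c)] with d hd hX hlog
      have h1 := mul_le_mul_of_nonneg_left (bias_blockStar_le hm1 hα hL hσ hd hmin) hK.le
      have h2 := mul_le_mul_of_nonneg_right (variance_blockStar_le hm1 hα hL hσ hd hX hmin) hc
      rw [htarget, hmin, mul_add (σ ^ 2), mul_div_right_comm _ c, ← mul_assoc (σ ^ 2)]
      linarith
    refine ⟨65, by norm_num, fun L σ hL hσ => ⟨?_, fun B ε hε => ?_⟩⟩
    · filter_upwards [hrate L σ 1 hL hσ one_pos] with d hd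
      refine le_trans ?_ hd
      have hlog : 0 ≤ Real.log d := Real.log_natCast_nonneg d
      rw [lseRate, one_mul]
      exact add_le_add le_rfl (le_mul_of_one_le_left (by positivity) (by norm_num))
    · obtain ⟨D, hD, h⟩ := exists_lseErrorBound_holder_of_bounded.{u} hm1 hα hL B
      filter_upwards [hrate L σ D hL hσ hD, eventually_ofReal_inv_natCast_le hε,
        eventually_ge_atTop 1] with d hd hdε hd1
      exact (h σ hσ d _ _ hd1 (one_le_blockStar hL hσ hd1)).mono hd hdε
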